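/- Let $\mathcal{L}_{\mathrm{TST}}$ be the many-sorted first-order language (with equality between terms of the same sort) with one sort ("type") for every $n \in \mathbb{N}$ and, for every $n$, a binary relation symbol $\in_n$ between type $n$ and type $n+1$; superscripts on variables denote types. The theory $\mathrm{TST}$ has the following axioms, for every $n \in \mathbb{N}$: (Extensionality) $\forall x^{n+1} \forall y^{n+1}\, \bigl(x^{n+1} = y^{n+1} \leftrightarrow \forall z^n (z^n \in_n x^{n+1} \leftrightarrow z^n \in_n y^{n+1})\bigr)$; (Comprehension) $\forall \vec{z}\, \exists y^{n+1} \forall x^n\, \bigl(x^n \in_n y^{n+1} \leftrightarrow \phi(x^n, \vec{z})\bigr)$ for every $\mathcal{L}_{\mathrm{TST}}$-formula $\phi(x^n, \vec{z})$ in which $y^{n+1}$ does not occur. The theory $\mathrm{TSTI}$ is $\mathrm{TST}$ together with the axiom $$\exists x^1 \exists f^3\, (f^3 : x^1 \to x^1 \text{ is a function that is injective but not surjective}),$$ where functions are sets of Kuratowski ordered pairs $\langle u, v \rangle = \{\{u\}, \{u, v\}\}$. A theory $T$ decides a sentence $\phi$ if $T \vdash \phi$ or $T \vdash \neg\phi$,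 where $\vdash$ is derivability in classical many-sorted first-order logic with equality (with all sorts non-empty). Corollary. Let $k, l, r_1, \ldots, r_k, s \in \mathbb{N}$, let $\theta$ be a quantifier-free $\mathcal{L}_{\mathrm{TST}}$-formula, and suppose that $$\phi = \forall x_1^{r_1} \cdots \forall x_k^{r_k}\, \exists y_1^{s} \cdots \exists y_l^{s}\, \theta$$ is a sentence. Then $\mathrm{TSTI}$ decides $\phi$. -/

import Mathlib

namespace TST

/-- Formulae of the `ℕ`-sorted language with membership symbols `∈ₙ` relating sort `n` to sort
`n + 1`.  The variables of sort `n` are `(n, 0), (n, 1), …`, in de Bruijn style with a separate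
numbering for every sort: the quantifier `all n φ` binds the variable `(n, 0)` of `φ`, and the
variable `(n, i + 1)` of `φ` is the variable `(n, i)` outside of the quantifier.  Variables of the
sorts other than `n` keep their number.  The connectives `⊥`, `→` and the quantifier `∀` are
primitive, the others are the usual classical abbreviations. -/
inductive Formula : Type
  /-- `eq n i j` is the equation between the variables `(n, i)` and `(n, j)`. -/
  | eq (n i j : ℕ) : Formula
  /-- `mem n i j` says that the variable `(n, i)` is a member of the variable `(n + 1, j)`. -/
  | mem (n i j : ℕ) : Formula
  | falsum : Formula
  | imp (φ ψ : Formula) : Formula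
  | all (n : ℕ) (φ : Formula) : Formula

namespace Formula

def neg (φ : Formula) : Formula := imp φ falsum

def or (φ ψ : Formula) : Formula := imp (neg φ) ψ

def and (φ ψ : Formula) : Formula := neg (imp φ (neg ψ))

def iff (φ ψ : Formula) : Formula := and (imp φ ψ) (imp ψ φ)

def ex (n : ℕ) (φ : Formula) : Formula := neg (all n (neg φ))

/-- `allBlock [r₁, …, rₖ] φ` is `∀ x₁ … ∀ xₖ φ` where `xᵢ` has sort `rᵢ`. -/
def allBlock (r : List ℕ) (φ : Formula) : Formula := r.foldr all φ

/-- `exBlock [s₁, …, sₗ] φ` is `∃ y₁ … ∃ yₗ φ` where `yᵢ` has sort `sᵢ`. -/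
def exBlock (s : List ℕ) (φ : Formula) : Formula := s.foldr ex φ

def QuantifierFree : Formula → Prop
  | eq _ _ _ => True
  | mem _ _ _ => True
  | falsum => True
  | imp φ ψ => QuantifierFree φ ∧ QuantifierFree ψ
  | all _ _ => False

/-- `HasFree φ m k`: the variable `(m, k)` occurs free in `φ`. -/
def HasFree : Formula → ℕ → ℕ → Prop
  | eq n i j, m, k => m = n ∧ (k = i ∨ k = j)
  | mem n i j, m, k => (m = n ∧ k = i) ∨ (m = n + 1 ∧ k = j)
  | falsum, _, _ => False
  | imp φ ψ, m, k => HasFree φ m k ∨ HasFree ψ m k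
  | all n φ, m, k => HasFree φ m (if m = n then k + 1 else k)

/-- A sentence is a formula without free variables. -/
def IsSentence (φ : Formula) : Prop := ∀ m k : ℕ, ¬ HasFree φ m k

/-- Extension of a sort-preserving renaming of variables to the scope of a quantifier of
sort `n`. -/
def up (n : ℕ) (ρ : ℕ → ℕ → ℕ) : ℕ → ℕ → ℕ :=
  Function.update ρ n (fun i => Nat.casesOn i 0 (fun i' => ρ n i' + 1))

/-- Capture-avoiding substitution of the variable `(n, ρ n i)` for every free variable
`(n, i)`.  The language has no function symbols, so variables are the only terms. -/
def rename : (ℕ → ℕ → ℕ) → Formula → Formula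
  | ρ, eq n i j => eq n (ρ n i) (ρ n j)
  | ρ, mem n i j => mem n (ρ n i) (ρ (n + 1) j)
  | _, falsum => falsum
  | ρ, imp φ ψ => imp (rename ρ φ) (rename ρ ψ)
  | ρ, all n φ => all n (rename (up n ρ) φ)

/-- `φ` as a formula in the scope of a further quantifier of sort `n` whose variable does not
occur in `φ`. -/
def shift (n : ℕ) (φ : Formula) : Formula :=
  rename (Function.update (fun _ i => i) n (fun i => i + 1)) φ

/-- The instance of the body `φ` of a quantifier of sort `n` at the variable `(n, j)`. -/
def inst (n j : ℕ) (φ : Formula) : Formula :=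
  rename (Function.update (fun _ i => i) n (fun i => Nat.casesOn i j (fun i' => i'))) φ

end Formula

open Formula

/-- Classical first-order natural deduction with equality: `Proves Γ φ` says that `φ` has a
(finite) derivation from hypotheses in `Γ`. -/
inductive Proves : Set Formula → Formula → Prop
  | hyp {Γ : Set Formula} {φ : Formula} (h : φ ∈ Γ) : Proves Γ φ
  | impI {Γ : Set Formula} {φ ψ : Formula} (h : Proves (insert φ Γ) ψ) : Proves Γ (imp φ ψ)
  | impE {Γ : Set Formula} {φ ψ : Formula} (h₁ : Proves Γ (imp φ ψ)) (h₂ : Proves Γ φ) :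
      Proves Γ ψ
  /-- reductio ad absurdum -/
  | raa {Γ : Set Formula} {φ : Formula} (h : Proves (insert (neg φ) Γ) falsum) : Proves Γ φ
  /-- generalization over a variable that does not occur in the hypotheses -/
  | allI {Γ : Set Formula} {n : ℕ} {φ : Formula} (h : Proves (shift n '' Γ) φ) :
      Proves Γ (all n φ)
  | allE {Γ : Set Formula} {n : ℕ} {φ : Formula} (j : ℕ) (h : Proves Γ (all n φ)) :
      Proves Γ (inst n j φ)
  | eqRefl {Γ : Set Formula} (n i : ℕ) : Proves Γ (eq n i i)
  | eqSubst {Γ : Set Formula} {n i j : ℕ} {φ : Formula} (h₁ : Proves Γ (eq n i j))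
      (h₂ : Proves Γ (inst n i φ)) : Proves Γ (inst n j φ)

/-- The theory `T` decides the sentence `φ`. -/
def Decides (T : Set Formula) (φ : Formula) : Prop := Proves T φ ∨ Proves T (neg φ)

/-- `∀ xⁿ⁺¹ ∀ yⁿ⁺¹ (x = y ↔ ∀ zⁿ (z ∈ x ↔ z ∈ y))` -/
def extensionality (n : ℕ) : Formula :=
  all (n + 1) (all (n + 1) (iff (eq (n + 1) 1 0) (all n (iff (mem n 0 1) (mem n 0 0)))))

/-- `∃ yⁿ⁺¹ ∀ xⁿ (x ∈ y ↔ φ(x, z⃗))`, where `x` is the variable `(n, 0)` of `φ`, the parameters `z⃗`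
are the other free variables of `φ`, and `y` does not occur in `φ`. -/
def comprehension (n : ℕ) (φ : Formula) : Formula :=
  ex (n + 1) (all n (iff (mem n 0 0) (shift (n + 1) φ)))

/-- The simple theory of types: extensionality, and all the sentences that arise from comprehension
by universally quantifying the parameters. -/
def tst : Set Formula :=
  {ψ | ∃ n : ℕ, ψ = extensionality n} ∪
  {ψ | ∃ (n : ℕ) (φ : Formula) (z : List ℕ),
    ψ = allBlock z (comprehension n φ) ∧ IsSentence ψ}

/-- `w¹ = {u⁰}` -/
def isSingleton (w u : ℕ) : Formula := all 0 (iff (mem 0 0 w) (eq 0 0 (u + 1)))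

/-- `w¹ = {u⁰, v⁰}` -/
def isUnorderedPair (w u v : ℕ) : Formula :=
  all 0 (iff (mem 0 0 w) (or (eq 0 0 (u + 1)) (eq 0 0 (v + 1))))

/-- `p² = ⟨u⁰, v⁰⟩ = {{u}, {u, v}}` -/
def isOrderedPair (p u v : ℕ) : Formula :=
  all 1 (iff (mem 1 0 p) (or (isSingleton 0 u) (isUnorderedPair 0 u v)))

/-- `⟨u⁰, v⁰⟩ ∈ f³` -/
def pairMem (u v f : ℕ) : Formula := ex 2 (and (isOrderedPair 0 u v) (mem 2 0 f))

/-- `f³ : x¹ → x¹` is a function, as a set of ordered pairs. -/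
def isSelfMap (f x : ℕ) : Formula :=
  and (all 2 (imp (mem 2 0 f)
        (ex 0 (ex 0 (and (mem 0 1 x) (and (mem 0 0 x) (isOrderedPair 0 1 0)))))))
    (and (all 0 (imp (mem 0 0 x) (ex 0 (and (mem 0 0 x) (pairMem 1 0 f)))))
      (all 0 (all 0 (all 0 (imp (pairMem 2 1 f) (imp (pairMem 2 0 f) (eq 0 1 0)))))))

/-- `f³` is injective: `⟨u, w⟩ ∈ f` and `⟨v, w⟩ ∈ f` imply `u = v`. -/
def isInjective (f : ℕ) : Formula :=
  all 0 (all 0 (all 0 (imp (pairMem 2 0 f) (imp (pairMem 1 0 f) (eq 0 2 1)))))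

/-- `f³` maps onto `x¹`. -/
def isOnto (f x : ℕ) : Formula :=
  all 0 (imp (mem 0 0 x) (ex 0 (and (mem 0 0 x) (pairMem 0 1 f))))

/-- `∃ x¹ ∃ f³ (f : x → x is injective but not surjective)` -/
def infinity : Formula :=
  ex 1 (ex 3 (and (isSelfMap 0 0) (and (isInjective 0) (neg (isOnto 0 0)))))

/-- The simple theory of types with infinity. -/
def tsti : Set Formula := insert infinity tst

end TST

/-!
The theorem is proved semantically. By the completeness theorem, a sentence that `TST.tsti` does
not decide is true in one model `M` of `TST.tsti` and false in another model `N`; so it suffices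
that the truth of a sentence `∀x⃗∃y⃗θ` of the given form transfers from every model `M` to every
model `N` (`TST.forall_sat_exBlock_transfer`).

*Completeness.* The axioms are sentences, so the free variables themselves can serve as Henkin
witnesses: at each stage of the construction only finitely many formulae have been added, and some
variable is fresh for all of them (`TST.Proves.all_of_inst_fresh`, `TST.exists_henkin`). The
variables modulo provable equality form the model. Soundness is not needed.

*Transfer.* Let `w` be parameters in `N` for the variables `x⃗`. They are copied, type by type, to
parameters `v` in `M` with the same equations and memberships, such that for all `y⃗` of type `s` in
`M` there are elements of `N` that relate to `w` as the `y⃗` relate to `v` (`TST.Back`). Only the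
parameters of types `s - 1`, `s` and `s + 1` relate to the `y⃗`.

In all types but `s + 1` the copy is easy, since every pattern of membership of finitely many given
objects is realized by infinitely many objects of the next type (`TST.infinite_setOf_pat_eq`). In
type `s + 1` one has to control how many objects of type `s` belong to which parameters. The
parameters of types `s - 1` and `s + 1` divide the type `s` of `N` into finitely many cells, and
among the cells with a given pattern with respect to type `s - 1` at least one is infinite. All
finite cells, together with finitely many other elements, are copied to `M`, and the copies of the
parameters of type `s + 1` are chosen so that the remaining elements of `M` fall into infinite
cells (`TST.exists_back`). The required sets exist by comprehension, being Boolean combinations of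
finite sets and of sets `{y | x ∈ y}`. Finitely many elements of `M` can then be mapped back
injectively, since there is always room in an infinite cell.
-/

namespace TST

open Formula

/-! ### Renaming of variables -/

theorem up_zero (n : ℕ) (ρ : ℕ → ℕ → ℕ) : up n ρ n 0 = 0 := by simp [up]

theorem up_succ (n : ℕ) (ρ : ℕ → ℕ → ℕ) (i : ℕ) : up n ρ n (i + 1) = ρ n i + 1 := by simp [up]

theorem up_of_ne {m n : ℕ} (h : m ≠ n) (ρ : ℕ → ℕ → ℕ) (i : ℕ) : up n ρ m i = ρ m i := by
  simp [up, h]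

theorem rename_congr {φ : Formula} : ∀ {ρ σ : ℕ → ℕ → ℕ},
    (∀ n i, HasFree φ n i → ρ n i = σ n i) → rename ρ φ = rename σ φ := by
  induction φ with
  | eq n i j =>
    intro ρ σ h
    simp only [rename, h n i (by simp [HasFree]), h n j (by simp [HasFree])]
  | mem n i j =>
    intro ρ σ h
    simp only [rename, h n i (by simp [HasFree]), h (n + 1) j (by simp [HasFree])]
  | falsum => intros; rfl
  | imp φ ψ ih₁ ih₂ =>
    intro ρ σ h
    simp only [rename, ih₁ fun n i hi => h n i (Or.inl hi), ih₂ fun n i hi => h n i (Or.inr hi)]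
  | all n φ ih =>
    intro ρ σ h
    simp only [rename]
    rw [ih]
    intro m i hi
    by_cases hm : m = n
    · subst hm
      cases i with
      | zero => simp only [up_zero]
      | succ i => simp only [up_succ, h m i (by simpa [HasFree] using hi)]
    · simp only [up_of_ne hm, h m i (by simpa [HasFree, hm] using hi)]

theorem up_comp (n : ℕ) (ρ σ : ℕ → ℕ → ℕ) :
    (fun m i => up n σ m (up n ρ m i)) = up n (fun m i => σ m (ρ m i)) := by
  funext m i
  by_cases hm : m = n
  · subst hm
    cases i <;> simp only [up_zero, up_succ]
  · simp only [up_of_ne hm]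

theorem rename_rename (φ : Formula) : ∀ ρ σ : ℕ → ℕ → ℕ,
    rename σ (rename ρ φ) = rename (fun m i => σ m (ρ m i)) φ := by
  induction φ with
  | eq n i j => intros; rfl
  | mem n i j => intros; rfl
  | falsum => intros; rfl
  | imp φ ψ ih₁ ih₂ => intro ρ σ; simp only [rename, ih₁, ih₂]
  | all n φ ih => intro ρ σ; simp only [rename, ih, up_comp]

theorem rename_id (φ : Formula) : rename (fun _ i => i) φ = φ := by
  induction φ with
  | eq n i j => rfl
  | mem n i j => rfl
  | falsum => rfl
  | imp φ ψ ih₁ ih₂ => simp only [rename, ih₁, ih₂]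
  | all n φ ih =>
    have h : up n (fun _ i => i) = fun _ i => i := by
      funext m i
      by_cases hm : m = n
      · subst hm
        cases i <;> simp only [up_zero, up_succ]
      · simp only [up_of_ne hm]
    simp only [rename, h, ih]

theorem rename_eq_self {φ : Formula} {ρ : ℕ → ℕ → ℕ}
    (h : ∀ n i, HasFree φ n i → ρ n i = i) : rename ρ φ = φ :=
  (rename_congr h).trans (rename_id φ)

theorem rename_inst (ρ : ℕ → ℕ → ℕ) (n j : ℕ) (φ : Formula) :
    rename ρ (inst n j φ) = inst n (ρ n j) (rename (up n ρ) φ) := by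
  simp only [inst, rename_rename]
  congr 1
  funext m i
  by_cases hm : m = n
  · subst hm
    cases i <;> simp [up_zero, up_succ]
  · simp [up_of_ne hm, hm]

theorem rename_shift (ρ : ℕ → ℕ → ℕ) (n : ℕ) (φ : Formula) :
    rename (up n ρ) (shift n φ) = shift n (rename ρ φ) := by
  simp only [shift, rename_rename]
  congr 1
  funext m i
  by_cases hm : m = n
  · subst hm
    simp [up_succ]
  · simp [up_of_ne hm, hm]

theorem exists_bound_hasFree (φ : Formula) : ∃ N, ∀ m k, HasFree φ m k → k < N := by
  induction φ with
  | eq n i j => exact ⟨i + j + 1, fun m k h => by simp only [HasFree] at h; omega⟩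
  | mem n i j => exact ⟨i + j + 1, fun m k h => by simp only [HasFree] at h; omega⟩
  | falsum => exact ⟨0, fun m k h => h.elim⟩
  | imp φ ψ ih₁ ih₂ =>
    obtain ⟨N₁, h₁⟩ := ih₁
    obtain ⟨N₂, h₂⟩ := ih₂
    exact ⟨N₁ + N₂, fun m k h => h.elim (fun h => by have := h₁ m k h; omega)
      (fun h => by have := h₂ m k h; omega)⟩
  | all n φ ih =>
    obtain ⟨N, hN⟩ := ih
    refine ⟨N, fun m k h => ?_⟩
    have := hN m _ h
    split_ifs at this <;> omega

/-! ### Structural properties of derivations -/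

theorem Proves.mono {Γ Δ : Set Formula} {φ : Formula} (h : Proves Γ φ) (hΓ : Γ ⊆ Δ) :
    Proves Δ φ := by
  induction h generalizing Δ with
  | hyp h => exact .hyp (hΓ h)
  | impI _ ih => exact .impI (ih (Set.insert_subset_insert hΓ))
  | impE _ _ ih₁ ih₂ => exact .impE (ih₁ hΓ) (ih₂ hΓ)
  | raa _ ih => exact .raa (ih (Set.insert_subset_insert hΓ))
  | allI _ ih => exact .allI (ih (Set.image_mono hΓ))
  | allE j _ ih => exact .allE j (ih hΓ)
  | eqRefl n i => exact .eqRefl n i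
  | eqSubst _ _ ih₁ ih₂ => exact .eqSubst (ih₁ hΓ) (ih₂ hΓ)

theorem Proves.rename {Γ : Set Formula} {φ : Formula} (h : Proves Γ φ) (ρ : ℕ → ℕ → ℕ) :
    Proves (Formula.rename ρ '' Γ) (Formula.rename ρ φ) := by
  induction h generalizing ρ with
  | hyp h => exact .hyp (Set.mem_image_of_mem _ h)
  | impI _ ih => exact .impI (by simpa only [Set.image_insert_eq] using ih ρ)
  | impE _ _ ih₁ ih₂ => exact .impE (ih₁ ρ) (ih₂ ρ)
  | raa _ ih =>
    have := ih ρ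
    rw [Set.image_insert_eq] at this
    exact .raa this
  | @allI Γ n φ _ ih =>
    refine .allI ?_
    have := ih (up n ρ)
    rw [Set.image_image] at this ⊢
    simpa only [rename_shift] using this
  | allE j _ ih =>
    rw [rename_inst]
    exact .allE _ (ih ρ)
  | eqRefl n i => exact .eqRefl n _
  | eqSubst _ _ ih₁ ih₂ =>
    rw [rename_inst]
    have := ih₂ ρ
    rw [rename_inst] at this
    exact .eqSubst (ih₁ ρ) this

theorem Proves.exists_finite_subset {Γ : Set Formula} {φ : Formula} (h : Proves Γ φ) :
    ∃ Δ ⊆ Γ, Δ.Finite ∧ Proves Δ φ := by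
  have insert_case : ∀ {Γ : Set Formula} {φ ψ : Formula},
      (∃ Δ ⊆ insert φ Γ, Δ.Finite ∧ Proves Δ ψ) →
      ∃ Δ ⊆ Γ, Δ.Finite ∧ Proves (insert φ Δ) ψ := by
    rintro Γ φ ψ ⟨Δ, hΔ, hf, hp⟩
    refine ⟨Δ \ {φ}, by simpa using hΔ, hf.sdiff, hp.mono ?_⟩
    intro χ hχ
    by_cases h : χ = φ <;> simp [h, hχ]
  induction h with
  | hyp h => exact ⟨{_}, by simpa using h, Set.finite_singleton _, .hyp rfl⟩
  | impI _ ih =>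
    obtain ⟨Δ, hΔ, hf, hp⟩ := insert_case ih
    exact ⟨Δ, hΔ, hf, .impI hp⟩
  | impE _ _ ih₁ ih₂ =>
    obtain ⟨Δ₁, hΔ₁, hf₁, hp₁⟩ := ih₁
    obtain ⟨Δ₂, hΔ₂, hf₂, hp₂⟩ := ih₂
    exact ⟨Δ₁ ∪ Δ₂, Set.union_subset hΔ₁ hΔ₂, hf₁.union hf₂,
      .impE (hp₁.mono Set.subset_union_left) (hp₂.mono Set.subset_union_right)⟩
  | raa _ ih =>
    obtain ⟨Δ, hΔ, hf, hp⟩ := insert_case ih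
    exact ⟨Δ, hΔ, hf, .raa hp⟩
  | allI _ ih =>
    obtain ⟨Δ, hΔ, hf, hp⟩ := ih
    obtain ⟨Δ', hΔ', hf', rfl⟩ := Set.exists_subset_image_finite_and.1 ⟨Δ, hΔ, hf, rfl⟩
    exact ⟨Δ', hΔ', hf', .allI hp⟩
  | allE j _ ih =>
    obtain ⟨Δ, hΔ, hf, hp⟩ := ih
    exact ⟨Δ, hΔ, hf, .allE j hp⟩
  | eqRefl n i => exact ⟨∅, Set.empty_subset _, Set.finite_empty, .eqRefl n i⟩
  | eqSubst _ _ ih₁ ih₂ =>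
    obtain ⟨Δ₁, hΔ₁, hf₁, hp₁⟩ := ih₁
    obtain ⟨Δ₂, hΔ₂, hf₂, hp₂⟩ := ih₂
    exact ⟨Δ₁ ∪ Δ₂, Set.union_subset hΔ₁ hΔ₂, hf₁.union hf₂,
      .eqSubst (hp₁.mono Set.subset_union_left) (hp₂.mono Set.subset_union_right)⟩

theorem Proves.of_falsum {Γ : Set Formula} (h : Proves Γ falsum) (φ : Formula) : Proves Γ φ :=
  .raa (h.mono (Set.subset_insert _ _))

theorem Proves.eq_symm {Γ : Set Formula} {n i j : ℕ} (h : Proves Γ (eq n i j)) :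
    Proves Γ (eq n j i) := by
  have := Proves.eqSubst (φ := eq n 0 (i + 1)) h (by simpa [inst, Formula.rename] using .eqRefl n i)
  simpa [inst, Formula.rename] using this

theorem Proves.eq_trans {Γ : Set Formula} {n i j k : ℕ} (h₁ : Proves Γ (eq n i j))
    (h₂ : Proves Γ (eq n j k)) : Proves Γ (eq n i k) := by
  have := Proves.eqSubst (φ := eq n (i + 1) 0) h₂ (by simpa [inst, Formula.rename] using h₁)
  simpa [inst, Formula.rename] using this

theorem Proves.mem_congr {Γ : Set Formula} {n i i' j j' : ℕ} (hi : Proves Γ (eq n i i'))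
    (hj : Proves Γ (eq (n + 1) j j')) (h : Proves Γ (mem n i j)) : Proves Γ (mem n i' j') := by
  have h₁ := Proves.eqSubst (φ := mem n 0 j) hi (by simpa [inst, Formula.rename] using h)
  have h₂ := Proves.eqSubst (φ := mem n i' 0) hj
    (by simpa [inst, Formula.rename] using h₁)
  simpa [inst, Formula.rename] using h₂

/-! ### Completeness -/

/-- A free variable that is fresh for the hypotheses may serve as a witness of the negation of a
universal statement: renaming it to the bound variable turns a refutation of the witness into a
derivation to which generalization applies. -/
theorem Proves.all_of_inst_fresh {Γ : Set Formula} {n j : ℕ} {φ : Formula}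
    (hΓ : ∀ γ ∈ Γ, ¬ HasFree γ n j) (hφ : ¬ HasFree (all n φ) n j) (h : Proves Γ (inst n j φ)) :
    Proves Γ (all n φ) := by
  let ρ : ℕ → ℕ → ℕ := Function.update (fun _ i => i) n (fun i => if i = j then 0 else i + 1)
  have key := h.rename ρ
  have hφ' : Formula.rename ρ (inst n j φ) = φ := by
    rw [inst, rename_rename]
    refine rename_eq_self fun m i hi => ?_
    by_cases hm : m = n
    · subst hm
      cases i with
      | zero => simp [ρ]
      | succ i =>
        have : i ≠ j := by
          rintro rfl
          exact hφ (by simpa [HasFree] using hi)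
        simp [ρ, this]
    · simp [ρ, hm]
  have hΓ' : Formula.rename ρ '' Γ = shift n '' Γ := by
    refine Set.image_congr fun γ hγ => rename_congr fun m i hi => ?_
    by_cases hm : m = n
    · subst hm
      have : i ≠ j := by
        rintro rfl
        exact hΓ γ hγ hi
      simp [ρ, this]
    · simp [ρ, hm]
  rw [hφ', hΓ'] at key
  exact .allI key

theorem exists_fresh {G : Set Formula} (hG : G.Finite) : ∃ j, ∀ γ ∈ G, ∀ n, ¬ HasFree γ n j := by
  choose b hb using exists_bound_hasFree
  obtain ⟨j, hj⟩ := (hG.image b).bddAbove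
  exact ⟨j, fun γ hγ n h => absurd (hb γ n j h) (not_lt.2 (hj (Set.mem_image_of_mem b hγ)))⟩

/-- An injective numbering of the formulae. -/
def Formula.code : Formula → ℕ
  | eq n i j => Nat.pair 0 (Nat.pair n (Nat.pair i j))
  | mem n i j => Nat.pair 1 (Nat.pair n (Nat.pair i j))
  | falsum => Nat.pair 2 0
  | imp φ ψ => Nat.pair 3 (Nat.pair (code φ) (code ψ))
  | all n φ => Nat.pair 4 (Nat.pair n (code φ))

theorem Formula.code_injective : Function.Injective code := by
  intro φ
  induction φ with
  | eq n i j => intro ψ h; cases ψ <;> simp_all [code]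
  | mem n i j => intro ψ h; cases ψ <;> simp_all [code]
  | falsum => intro ψ h; cases ψ <;> simp_all [code]
  | imp φ ψ ih₁ ih₂ =>
    intro χ h
    cases χ with
    | imp φ' ψ' =>
      simp only [code, Nat.pair_eq_pair, true_and] at h
      rw [ih₁ h.1, ih₂ h.2]
    | _ => simp [code] at h
  | all n φ ih =>
    intro χ h
    cases χ with
    | all n' φ' =>
      simp only [code, Nat.pair_eq_pair, true_and] at h
      rw [h.1, ih h.2]
    | _ => simp [code] at h

/-- A consistent set of formulae that is complete and contains witnesses. -/
structure IsHenkin (Δ : Set Formula) : Prop where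
  consistent : ¬ Proves Δ falsum
  complete : ∀ φ, Proves Δ φ ∨ Proves Δ (neg φ)
  witness : ∀ n φ, (∀ j, Proves Δ (inst n j φ)) → Proves Δ (all n φ)

theorem exists_henkin_step {T G : Set Formula} (hT : ∀ φ ∈ T, IsSentence φ) (hG : G.Finite)
    (hc : ¬ Proves (T ∪ G) falsum) (ψ : Formula) :
    ∃ G', G ⊆ G' ∧ G'.Finite ∧ ¬ Proves (T ∪ G') falsum ∧ (ψ ∈ G' ∨ Proves (T ∪ G) (neg ψ)) ∧
      ∀ n χ, ψ = neg (all n χ) → ψ ∈ G' → ∃ j, neg (inst n j χ) ∈ G' := by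
  by_cases hψ : Proves (T ∪ insert ψ G) falsum
  · by_cases hmem : ψ ∈ G
    · rw [Set.insert_eq_of_mem hmem] at hψ
      exact (hc hψ).elim
    · refine ⟨G, subset_rfl, hG, hc, Or.inr (.impI ?_), fun n χ _ h => (hmem h).elim⟩
      rwa [← Set.union_insert]
  · have hfin : (insert ψ G).Finite := hG.insert ψ
    by_cases hall : ∃ n χ, ψ = neg (all n χ)
    · obtain ⟨n, χ, rfl⟩ := hall
      obtain ⟨j, hj⟩ := exists_fresh hfin
      refine ⟨insert (neg (inst n j χ)) (insert (neg (all n χ)) G),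
        (Set.subset_insert _ _).trans (Set.subset_insert _ _), hfin.insert _, ?_,
        Or.inl (by simp), ?_⟩
      · intro h
        rw [Set.union_insert] at h
        have h' : Proves (T ∪ insert (neg (all n χ)) G) (all n χ) := by
          refine Proves.all_of_inst_fresh (j := j) ?_ ?_ (.raa h)
          · rintro γ (hγ | hγ)
            · exact hT γ hγ n j
            · exact hj γ hγ n
          · exact fun h => hj _ (Set.mem_insert _ _) n (Or.inl h)
        exact hψ (.impE (.hyp (Or.inr (Set.mem_insert _ _))) h')
      · intro n' χ' h _
        simp only [neg, imp.injEq, all.injEq, and_true] at h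
        obtain ⟨rfl, rfl⟩ := h
        exact ⟨j, Set.mem_insert _ _⟩
    · exact ⟨insert ψ G, Set.subset_insert _ _, hfin, hψ, Or.inl (Set.mem_insert _ _),
        fun n χ h => (hall ⟨n, χ, h⟩).elim⟩

theorem exists_henkin {T : Set Formula} (hT : ∀ φ ∈ T, IsSentence φ) (hc : ¬ Proves T falsum) :
    ∃ Δ, T ⊆ Δ ∧ IsHenkin Δ := by
  have : Nonempty Formula := ⟨falsum⟩
  let S := {G : Set Formula // G.Finite ∧ ¬ Proves (T ∪ G) falsum}
  choose next hsub hfin hcon hdec hwit using fun (G : S) (ψ : Formula) =>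
    exists_henkin_step hT G.2.1 G.2.2 ψ
  let G : ℕ → S := fun k => Nat.rec ⟨∅, Set.finite_empty, by simpa using hc⟩
    (fun k G => ⟨next G (Function.invFun code k), hfin _ _, hcon _ _⟩) k
  have hmono : Monotone fun k => (G k).1 := monotone_nat_of_le_succ fun k => hsub (G k) _
  have hψ : ∀ ψ : Formula, (G (ψ.code + 1)).1 = next (G ψ.code) ψ := fun ψ => by
    change next (G ψ.code) (Function.invFun code ψ.code) = _
    rw [Function.leftInverse_invFun code_injective]
  let Δ := T ∪ ⋃ k, (G k).1
  have hle : ∀ k, T ∪ (G k).1 ⊆ Δ := fun k =>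
    Set.union_subset_union_right _ (Set.subset_iUnion (fun k => (G k).1) k)
  have hcons : ¬ Proves Δ falsum := by
    intro h
    obtain ⟨Δ₀, hΔ₀, hf, hp⟩ := h.exists_finite_subset
    have : ∃ k, Δ₀ ⊆ T ∪ (G k).1 := by
      have hsub' : Δ₀ \ T ⊆ ⋃ k, (G k).1 := fun x hx => (hΔ₀ hx.1).resolve_left hx.2
      obtain ⟨k, hk⟩ := (hmono.directed_le).exists_mem_subset_of_finset_subset_biUnion
        (s := hf.sdiff.toFinset) (by simpa using hsub')
      refine ⟨k, fun x hx => ?_⟩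
      by_cases hxT : x ∈ T
      · exact Or.inl hxT
      · exact Or.inr (hk (by simpa using ⟨hx, hxT⟩))
    obtain ⟨k, hk⟩ := this
    exact (G k).2.2 (hp.mono hk)
  have hcomp : ∀ φ, φ ∈ next (G φ.code) φ ∨ Proves Δ (neg φ) := fun φ =>
    (hdec (G φ.code) φ).imp id fun h => h.mono (hle _)
  have hnext : ∀ φ, next (G φ.code) φ ⊆ Δ := fun φ => by
    rw [← hψ]
    exact Set.subset_union_right.trans (hle (φ.code + 1))
  refine ⟨Δ, Set.subset_union_left, hcons, fun φ => ?_, fun n φ h => ?_⟩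
  · exact (hcomp φ).imp (fun h => .hyp (hnext φ h)) id
  · rcases hcomp (neg (all n φ)) with h' | h'
    · obtain ⟨j, hj⟩ := hwit _ _ n φ rfl h'
      exact (hcons (.impE (.hyp (hnext _ hj)) (h j))).elim
    · exact .raa (.impE (h'.mono (Set.subset_insert _ _)) (.hyp (Set.mem_insert _ _)))

/-- A structure for the language of type theory, with all sorts non-empty. -/
structure Model where
  /-- the objects of type `n` -/
  dom : ℕ → Type
  nonempty : ∀ n, Nonempty (dom n)
  /-- membership of objects of type `n` in objects of type `n + 1` -/
  mem : ∀ {n}, dom n → dom (n + 1) → Prop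

/-- The assignment in the scope of a quantifier of sort `n` whose variable has the value `d`. -/
def push {D : ℕ → Type} (n : ℕ) (d : D n) (v : ∀ n, ℕ → D n) : ∀ n, ℕ → D n :=
  Function.update v n (fun i => Nat.casesOn i d (v n))

section push

variable {D : ℕ → Type} {n : ℕ} (d : D n) (v : ∀ n, ℕ → D n)

@[simp] theorem push_zero : push n d v n 0 = d := by simp [push]

@[simp] theorem push_succ (i : ℕ) : push n d v n (i + 1) = v n i := by simp [push]

@[simp] theorem push_of_ne {m : ℕ} (h : m ≠ n) : push n d v m = v m := by simp [push, h]

end push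

/-- Satisfaction of a formula under an assignment of values to the variables. -/
def Sat (M : Model) : Formula → (∀ n, ℕ → M.dom n) → Prop
  | eq n i j, v => v n i = v n j
  | mem n i j, v => M.mem (v n i) (v (n + 1) j)
  | falsum, _ => False
  | imp φ ψ, v => Sat M φ v → Sat M ψ v
  | all n φ, v => ∀ d, Sat M φ (push n d v)

/-- Provable equality of the variables of sort `n`. -/
def provablyEq (Δ : Set Formula) (n : ℕ) : Setoid ℕ where
  r i j := Proves Δ (eq n i j)
  iseqv := ⟨fun i => .eqRefl n i, Proves.eq_symm, Proves.eq_trans⟩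

/-- The model of the variables modulo provable equality. -/
def termModel (Δ : Set Formula) : Model where
  dom n := Quotient (provablyEq Δ n)
  nonempty _ := ⟨Quotient.mk _ 0⟩
  mem {n} := Quotient.lift₂ (fun i j => Proves Δ (Formula.mem n i j)) fun _ _ _ _ hi hj =>
    propext ⟨Proves.mem_congr hi hj, Proves.mem_congr (Proves.eq_symm hi) (Proves.eq_symm hj)⟩

/-- The assignment in the term model given by a renaming of variables. -/
def termAssignment (Δ : Set Formula) (ρ : ℕ → ℕ → ℕ) : ∀ n, ℕ → (termModel Δ).dom n :=
  fun n i => Quotient.mk (provablyEq Δ n) (ρ n i)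

theorem push_termAssignment (Δ : Set Formula) (ρ : ℕ → ℕ → ℕ) (n j : ℕ) :
    push n (Quotient.mk (provablyEq Δ n) j : (termModel Δ).dom n) (termAssignment Δ ρ) =
      termAssignment Δ (push (D := fun _ => ℕ) n j ρ) := by
  funext m i
  by_cases hm : m = n
  · subst hm
    cases i with
    | zero => exact (push_zero _ _).trans (by simp only [termAssignment, push_zero]; rfl)
    | succ i => exact (push_succ _ _ i).trans (by simp only [termAssignment, push_succ]; rfl)
  · exact (congrFun (push_of_ne _ _ hm) i).trans (by simp only [termAssignment, push_of_ne _ _ hm]; rfl)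

theorem inst_rename_up (n j : ℕ) (ρ : ℕ → ℕ → ℕ) (φ : Formula) :
    inst n j (rename (up n ρ) φ) = rename (push (D := fun _ => ℕ) n j ρ) φ := by
  rw [inst, rename_rename]
  congr 1
  funext m i
  by_cases hm : m = n
  · subst hm
    cases i <;> simp [up_zero, up_succ]
  · simp [up_of_ne hm, hm]

theorem IsHenkin.sat_iff {Δ : Set Formula} (hΔ : IsHenkin Δ) (φ : Formula) :
    ∀ ρ, Sat (termModel Δ) φ (termAssignment Δ ρ) ↔ Proves Δ (rename ρ φ) := by
  induction φ with
  | eq n i j => intro ρ; exact Quotient.eq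
  | mem n i j => intro ρ; exact Iff.rfl
  | falsum => intro ρ; exact ⟨False.elim, hΔ.consistent⟩
  | imp φ ψ ih₁ ih₂ =>
    intro ρ
    simp only [Sat, rename, ih₁, ih₂]
    refine ⟨fun h => ?_, fun h h' => .impE h h'⟩
    rcases hΔ.complete (rename ρ φ) with h' | h'
    · exact .impI ((h h').mono (Set.subset_insert _ _))
    · exact .impI (Proves.of_falsum
        (.impE (h'.mono (Set.subset_insert _ _)) (.hyp (Set.mem_insert _ _))) _)
  | all n φ ih =>
    intro ρ
    have key : ∀ j, Sat (termModel Δ) φ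
        (push n (Quotient.mk (provablyEq Δ n) j : (termModel Δ).dom n) (termAssignment Δ ρ)) ↔
        Proves Δ (inst n j (rename (up n ρ) φ)) := fun j => by
      rw [push_termAssignment, ih, inst_rename_up]
    simp only [Sat, rename]
    exact ⟨fun h => hΔ.witness n _ fun j => (key j).1 (h _),
      fun h d => Quotient.inductionOn d fun j => (key j).2 (.allE j h)⟩

/-- The completeness theorem for sentences. -/
theorem exists_model_of_not_proves {T : Set Formula} (hT : ∀ φ ∈ T, IsSentence φ)
    (hc : ¬ Proves T falsum) :
    ∃ (M : Model) (v : ∀ n, ℕ → M.dom n), ∀ φ ∈ T, Sat M φ v := by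
  obtain ⟨Δ, hTΔ, hΔ⟩ := exists_henkin hT hc
  refine ⟨termModel Δ, termAssignment Δ fun _ i => i, fun φ hφ => ?_⟩
  rw [hΔ.sat_iff, rename_id]
  exact .hyp (hTΔ hφ)

/-! ### Satisfaction -/

section sat

variable {M : Model} {φ ψ : Formula} {v : ∀ n, ℕ → M.dom n}

@[simp] theorem sat_neg : Sat M (neg φ) v ↔ ¬ Sat M φ v := Iff.rfl

@[simp] theorem sat_or : Sat M (Formula.or φ ψ) v ↔ Sat M φ v ∨ Sat M ψ v := by
  simp only [Formula.or, Sat, sat_neg]; tauto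

@[simp] theorem sat_and : Sat M (Formula.and φ ψ) v ↔ Sat M φ v ∧ Sat M ψ v := by
  simp only [Formula.and, Sat, sat_neg]; tauto

@[simp] theorem sat_iff : Sat M (iff φ ψ) v ↔ (Sat M φ v ↔ Sat M ψ v) := by
  simp only [iff, Sat, sat_and]; tauto

@[simp] theorem sat_ex {n : ℕ} : Sat M (ex n φ) v ↔ ∃ d, Sat M φ (push n d v) := by
  simp only [ex, Sat, sat_neg, not_forall, not_not]

end sat

theorem sat_congr {M : Model} {φ : Formula} : ∀ {v w : ∀ n, ℕ → M.dom n},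
    (∀ n i, HasFree φ n i → v n i = w n i) → (Sat M φ v ↔ Sat M φ w) := by
  induction φ with
  | eq n i j =>
    intro v w h
    simp only [Sat, h n i (by simp [HasFree]), h n j (by simp [HasFree])]
  | mem n i j =>
    intro v w h
    simp only [Sat, h n i (by simp [HasFree]), h (n + 1) j (by simp [HasFree])]
  | falsum => intros; rfl
  | imp φ ψ ih₁ ih₂ =>
    intro v w h
    simp only [Sat, ih₁ fun n i hi => h n i (Or.inl hi), ih₂ fun n i hi => h n i (Or.inr hi)]
  | all n φ ih =>
    intro v w h
    simp only [Sat]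
    refine forall_congr' fun d => ih fun m i hi => ?_
    by_cases hm : m = n
    · subst hm
      cases i with
      | zero => simp
      | succ i => simp [h m i (by simpa [HasFree] using hi)]
    · simp [hm, h m i (by simpa [HasFree, hm] using hi)]

theorem Formula.IsSentence.sat_congr {M : Model} {φ : Formula} (h : IsSentence φ)
    (v w : ∀ n, ℕ → M.dom n) : Sat M φ v ↔ Sat M φ w :=
  TST.sat_congr fun n i hi => (h n i hi).elim

/-- Universal quantifiers may be dropped in front of a formula that is to hold under all
assignments. -/
theorem forall_sat_allBlock {M : Model} (r : List ℕ) (φ : Formula) :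
    (∀ v, Sat M (allBlock r φ) v) ↔ ∀ v, Sat M φ v := by
  induction r with
  | nil => rfl
  | cons n r ih =>
    rw [← ih]
    refine ⟨fun h v => ?_, fun h v d => h _⟩
    have := h (Function.update v n fun i => v n (i + 1)) (v n 0)
    change Sat M (allBlock r φ) _ at this
    convert this using 1
    funext m i
    by_cases hm : m = n
    · subst hm
      cases i <;> simp
    · simp [hm]

theorem sat_exBlock_replicate {M : Model} (l s : ℕ) (θ : Formula) : ∀ v : ∀ n, ℕ → M.dom n,
    Sat M (exBlock (List.replicate l s) θ) v ↔
      ∃ v' : ∀ n, ℕ → M.dom n, (∀ n, n ≠ s → v' n = v n) ∧ (∀ i, v' s (i + l) = v s i) ∧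
        Sat M θ v' := by
  induction l with
  | zero =>
    intro v
    refine ⟨fun h => ⟨v, fun _ _ => rfl, fun _ => rfl, h⟩, ?_⟩
    rintro ⟨v', h₁, h₂, h₃⟩
    have : v' = v := by
      funext n i
      by_cases hn : n = s
      · subst hn
        exact h₂ i
      · rw [h₁ n hn]
    rwa [this] at h₃
  | succ l ih =>
    intro v
    change Sat M (ex s (exBlock (List.replicate l s) θ)) v ↔ _
    simp only [sat_ex, ih]
    constructor
    · rintro ⟨d, v', h₁, h₂, h₃⟩
      refine ⟨v', fun n hn => by rw [h₁ n hn, push_of_ne _ _ hn], fun i => ?_, h₃⟩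
      have := h₂ (i + 1)
      rwa [push_succ, show i + 1 + l = i + (l + 1) by omega] at this
    · rintro ⟨v', h₁, h₂, h₃⟩
      refine ⟨v' s l, v', fun n hn => by rw [h₁ n hn, push_of_ne _ _ hn], fun i => ?_, h₃⟩
      cases i with
      | zero => simp
      | succ i => rw [push_succ, ← h₂ i, show i + 1 + l = i + (l + 1) by omega]

/-! ### Infinite models of type theory -/

/-- `S` is the extension of an object of the model. -/
def Internal (M : Model) {n : ℕ} (S : Set (M.dom n)) : Prop :=
  ∃ y : M.dom (n + 1), ∀ x, M.mem x y ↔ x ∈ S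

/-- The consequences of the axioms that the transfer argument uses: extensionality, quantifier-free
comprehension, given by closure conditions on extensions, and infinity of all sorts. -/
structure IsTypeTheory (M : Model) : Prop where
  ext {n : ℕ} {x y : M.dom (n + 1)} : (∀ z, M.mem z x ↔ M.mem z y) → x = y
  compl {n : ℕ} {S : Set (M.dom n)} : Internal M S → Internal M Sᶜ
  union {n : ℕ} {S T : Set (M.dom n)} : Internal M S → Internal M T → Internal M (S ∪ T)
  singleton {n : ℕ} (x : M.dom n) : Internal M {x}
  above {n : ℕ} (x : M.dom n) : Internal M {y | M.mem x y}
  infinite (n : ℕ) : Infinite (M.dom n)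

theorem isSentence_extensionality (n : ℕ) : IsSentence (extensionality n) := by
  intro m k
  simp only [extensionality, iff, Formula.and, neg, HasFree, or_false]
  split_ifs <;> simp <;> omega

theorem isSentence_infinity : IsSentence infinity := by
  intro m k
  simp only [infinity, isSelfMap, isInjective, isOnto, pairMem, isOrderedPair, isSingleton,
    isUnorderedPair, ex, iff, Formula.and, Formula.or, neg, HasFree, or_false]
  rcases m with _ | _ | _ | _ | m <;> simp

theorem isSentence_of_mem_tsti {φ : Formula} (h : φ ∈ tsti) : IsSentence φ := by
  rcases h with rfl | ⟨n, rfl⟩ | ⟨n, φ, z, rfl, h⟩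
  · exact isSentence_infinity
  · exact isSentence_extensionality n
  · exact h

/-- The pair `⟨a, b⟩` is a member of `f`. -/
def PairMem (M : Model) (a b : M.dom 0) (f : M.dom 3) : Prop :=
  ∃ p : M.dom 2, (∀ w : M.dom 1, M.mem w p ↔
    ((∀ z, M.mem z w ↔ z = a) ∨ ∀ z, M.mem z w ↔ z = a ∨ z = b)) ∧ M.mem p f

theorem sat_pairMem {M : Model} {v : ∀ n, ℕ → M.dom n} (i j k : ℕ) :
    Sat M (pairMem i j k) v ↔ PairMem M (v 0 i) (v 0 j) (v 3 k) := by
  simp [pairMem, isOrderedPair, isSingleton, isUnorderedPair, Sat, PairMem]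

section axioms

variable {M : Model} {v : ∀ n, ℕ → M.dom n} (h : ∀ φ ∈ tsti, Sat M φ v)

include h

theorem ext_of_sat {n : ℕ} {x y : M.dom (n + 1)} (hxy : ∀ z, M.mem z x ↔ M.mem z y) : x = y := by
  have := h (extensionality n) (Or.inr (Or.inl ⟨n, rfl⟩)) x y
  simpa [Sat, hxy] using this

theorem internal_compl_of_sat {n : ℕ} {S : Set (M.dom n)} (hS : Internal M S) :
    Internal M Sᶜ := by
  obtain ⟨y, hy⟩ := hS
  have := h (allBlock [n + 1] (comprehension n (neg (Formula.mem n 0 0))))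
    (Or.inr (Or.inr ⟨_, _, _, rfl, fun m k => by
      simp only [allBlock, List.foldr, comprehension, shift, rename, ex, iff, Formula.and, neg,
        HasFree, Function.update_self]
      split_ifs <;> simp <;> omega⟩)) y
  simpa [Sat, comprehension, shift, rename, neg, Internal, hy] using this

theorem internal_union_of_sat {n : ℕ} {S T : Set (M.dom n)} (hS : Internal M S)
    (hT : Internal M T) : Internal M (S ∪ T) := by
  obtain ⟨y, hy⟩ := hS
  obtain ⟨z, hz⟩ := hT
  have := h (allBlock [n + 1, n + 1]
      (comprehension n (Formula.or (Formula.mem n 0 1) (Formula.mem n 0 0))))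
    (Or.inr (Or.inr ⟨_, _, _, rfl, fun m k => by
      simp only [allBlock, List.foldr, comprehension, shift, rename, ex, iff, Formula.and, neg,
        Formula.or, HasFree, Function.update_self]
      split_ifs <;> simp <;> omega⟩)) y z
  simpa [Sat, comprehension, shift, rename, neg, Formula.or, Internal, hy, hz,
    or_iff_not_imp_left] using this

theorem internal_singleton_of_sat {n : ℕ} (x : M.dom n) : Internal M {x} := by
  have := h (allBlock [n] (comprehension n (Formula.eq n 0 1)))
    (Or.inr (Or.inr ⟨_, _, _, rfl, fun m k => by
      simp only [allBlock, List.foldr, comprehension, shift, rename, ex, iff, Formula.and, neg,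
        HasFree]
      split_ifs <;> simp <;> omega⟩)) x
  simpa [Sat, comprehension, shift, rename, Internal] using this

theorem internal_above_of_sat {n : ℕ} (x : M.dom n) : Internal M {y | M.mem x y} := by
  have := h (allBlock [n] (comprehension (n + 1) (Formula.mem n 0 0)))
    (Or.inr (Or.inr ⟨_, _, _, rfl, fun m k => by
      simp only [allBlock, List.foldr, comprehension, shift, rename, ex, iff, Formula.and, neg,
        HasFree, or_false]
      have h₁ : n ≠ n + 1 + 1 := by omega
      rw [Function.update_of_ne h₁]
      split_ifs <;> simp
      omega⟩)) x
  simpa [Sat, comprehension, shift, rename, Internal, show n ≠ n + 1 + 1 by omega] using this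

/-- A non-surjective injection of the extension of an object of type `1` into itself, given by an
object of type `3`, makes that extension infinite. -/
theorem infinite_zero_of_sat : Infinite (M.dom 0) := by
  have := h infinity (Or.inl rfl)
  rw [infinity, sat_ex] at this
  obtain ⟨x, this⟩ := this
  rw [sat_ex] at this
  obtain ⟨f, this⟩ := this
  simp only [isSelfMap, isInjective, isOnto, sat_and, sat_neg, Sat, sat_ex, sat_pairMem] at this
  simp only [push_zero, push_succ, ne_eq, push_of_ne, not_false_eq_true, OfNat.ofNat_ne_zero]
    at this
  -- The remaining updates at the other sorts compute away.
  have htot : ∀ a, M.mem a x → ∃ b, M.mem b x ∧ PairMem M a b f := this.1.2.1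
  have hinj : ∀ a b c, PairMem M a c f → PairMem M b c f → a = b := this.2.1
  have honto : ¬ ∀ b, M.mem b x → ∃ a, M.mem a x ∧ PairMem M a b f := this.2.2
  choose g hg hgf using htot
  let F : {a // M.mem a x} → {a // M.mem a x} := fun a => ⟨g a a.2, hg a a.2⟩
  have hF : Function.Injective F := fun a b hab => by
    have hab' : g a a.2 = g b b.2 := congrArg Subtype.val hab
    refine Subtype.ext (hinj _ _ _ (hgf a a.2) ?_)
    rw [hab']
    exact hgf b b.2
  by_contra hfin
  rw [not_infinite_iff_finite] at hfin
  refine honto fun b hb => ?_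
  obtain ⟨a, ha⟩ := Finite.surjective_of_injective hF ⟨b, hb⟩
  have ha' : g a a.2 = b := congrArg Subtype.val ha
  exact ⟨a, a.2, ha' ▸ hgf a a.2⟩

theorem isTypeTheory_of_sat : IsTypeTheory M where
  ext := ext_of_sat h
  compl := internal_compl_of_sat h
  union := internal_union_of_sat h
  singleton := internal_singleton_of_sat h
  above := internal_above_of_sat h
  infinite n := by
    induction n with
    | zero => exact infinite_zero_of_sat h
    | succ n ih =>
      choose y hy using fun x : M.dom n => internal_singleton_of_sat h x
      refine Infinite.of_injective y fun a b hab => ?_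
      have := (hy a a).2 rfl
      rw [hab] at this
      exact (hy b a).1 this

end axioms

namespace IsTypeTheory

variable {M : Model} (hM : IsTypeTheory M) {n : ℕ}

include hM

theorem inter {S T : Set (M.dom n)} (hS : Internal M S) (hT : Internal M T) :
    Internal M (S ∩ T) := by
  have := hM.compl (hM.union (hM.compl hS) (hM.compl hT))
  rwa [Set.compl_union, compl_compl, compl_compl] at this

theorem empty : Internal M (∅ : Set (M.dom n)) := by
  obtain ⟨x⟩ := M.nonempty n
  simpa using hM.inter (hM.singleton x) (hM.compl (hM.singleton x))

theorem of_finite {S : Set (M.dom n)} (hS : S.Finite) : Internal M S := by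
  induction S, hS using Set.Finite.induction_on with
  | empty => exact hM.empty
  | insert _ _ ih => exact hM.union (hM.singleton _) ih

/-- A Boolean combination of finitely many extensions is an extension. -/
theorem setOf_boolean (S : ℕ → Set (M.dom n)) (hS : ∀ i, Internal M (S i)) (K : ℕ) :
    ∀ Q : Set ℕ → Prop, Internal M {z | Q {i | i < K ∧ z ∈ S i}} := by
  classical
  induction K with
  | zero =>
    intro Q
    by_cases h : Q ∅
    · simpa [h] using hM.compl hM.empty
    · simpa [h] using hM.empty
  | succ K ih =>
    intro Q
    convert hM.union (hM.inter (hS K) (ih fun p => Q (insert K p)))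
      (hM.inter (hM.compl (hS K)) (ih Q)) using 1
    ext z
    have key : {i | i < K + 1 ∧ z ∈ S i} =
        if z ∈ S K then insert K {i | i < K ∧ z ∈ S i} else {i | i < K ∧ z ∈ S i} := by
      ext i
      rcases Nat.lt_trichotomy i K with hi | rfl | hi
      · split_ifs <;> simp [hi, hi.ne, hi.le]
      · split_ifs with hz <;> simp [hz]
      · split_ifs <;> simp [hi.ne', hi.not_ge, hi.le.not_gt]
    simp only [Set.mem_ofPred_eq, Set.mem_union, Set.mem_inter_iff, Set.mem_compl_iff, key]
    split_ifs with hz <;> simp [hz]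

end IsTypeTheory

/-! ### Patterns of membership -/

/-- The indices `i < K` of those objects `v (s - 1) i` that are members of the object `z` of
type `s`; there are none if `s = 0`. -/
def pat {M : Model} (K : ℕ) (v : ∀ n, ℕ → M.dom n) : ∀ s, M.dom s → Set ℕ
  | 0, _ => ∅
  | n + 1, z => {i | i < K ∧ M.mem (v n i) z}

theorem pat_congr {M : Model} {K : ℕ} {v v' : ∀ n, ℕ → M.dom n} {s : ℕ}
    (h : ∀ n, n < s → v n = v' n) (z : M.dom s) : pat K v s z = pat K v' s z := by
  cases s with
  | zero => rfl
  | succ n => simp only [pat, h n n.lt_succ_self]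

theorem pat_subset {M : Model} {K : ℕ} (v : ∀ n, ℕ → M.dom n) (s : ℕ) (z : M.dom s) :
    pat K v s z ⊆ Set.Iio K := by
  cases s with
  | zero => exact Set.empty_subset _
  | succ n => exact fun i hi => hi.1

theorem IsTypeTheory.internal_pat {M : Model} (hM : IsTypeTheory M) (K : ℕ)
    (v : ∀ n, ℕ → M.dom n) (s : ℕ) (Q : Set ℕ → Prop) : Internal M {z | Q (pat K v s z)} := by
  cases s with
  | zero =>
    by_cases h : Q ∅
    · simpa [pat, h] using hM.compl hM.empty
    · simpa [pat, h] using hM.empty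
  | succ n => exact hM.setOf_boolean _ (fun i => hM.above (v n i)) K Q

/-- The equations that hold between the first `K` objects of type `n` are the same for `v`
and `w`. -/
def EqSim {M N : Model} (K : ℕ) (v : ∀ n, ℕ → M.dom n) (w : ∀ n, ℕ → N.dom n) (n : ℕ) : Prop :=
  ∀ i < K, ∀ j < K, v n i = v n j ↔ w n i = w n j

/-- The equations between the first `K` objects of type `n`, and the membership of the first `K`
objects of the type below in them, are the same for `v` and `w`. -/
def Sim {M N : Model} (K : ℕ) (v : ∀ n, ℕ → M.dom n) (w : ∀ n, ℕ → N.dom n) (n : ℕ) : Prop :=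
  EqSim K v w n ∧ ∀ j < K, pat K v n (v n j) = pat K w n (w n j)

theorem Sim.congr {M N : Model} {K : ℕ} {v v' : ∀ n, ℕ → M.dom n} {w : ∀ n, ℕ → N.dom n} {n : ℕ}
    (h : Sim K v w n) (hv : ∀ m ≤ n, v m = v' m) : Sim K v' w n := by
  refine ⟨fun i hi j hj => ?_, fun j hj => ?_⟩
  · rw [← hv n le_rfl]
    exact h.1 i hi j hj
  · rw [← h.2 j hj, ← hv n le_rfl, pat_congr fun m hm => (hv m hm.le).symm]

/-- A pattern realized in one model is realized infinitely often in every other one: add a single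
arbitrary further member to the finite set of the prescribed members. -/
theorem infinite_setOf_pat_eq {M N : Model} (hN : IsTypeTheory N) {K s : ℕ}
    {v : ∀ n, ℕ → M.dom n} {w : ∀ n, ℕ → N.dom n} (h : ∀ n < s, EqSim K v w n) (z : M.dom s) :
    {y | pat K w s y = pat K v s z}.Infinite := by
  cases s with
  | zero =>
    have := hN.infinite 0
    simpa [pat] using Set.infinite_univ (α := N.dom 0)
  | succ n =>
    have := hN.infinite n
    have hfin : (w n '' Set.Iio K).Finite := (Set.finite_Iio K).image _
    have hsub : w n '' pat K v (n + 1) z ⊆ w n '' Set.Iio K :=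
      Set.image_mono (pat_subset v _ z)
    choose y hy using fun e : N.dom n =>
      hN.of_finite ((hfin.subset hsub).insert e)
    refine Set.infinite_of_injOn_mapsTo (f := y) (s := (w n '' Set.Iio K)ᶜ) ?_ ?_
      hfin.infinite_compl
    · intro e he e' he' hee
      have : e ∈ insert e' (w n '' pat K v (n + 1) z) := by
        rw [← hy, ← hee, hy]
        exact Set.mem_insert _ _
      exact this.resolve_right fun h => he (hsub h)
    · intro e he
      ext j
      simp only [pat, Set.mem_ofPred_eq, hy]
      refine and_congr_right fun hj => ⟨?_, fun hz => Or.inr ⟨j, ⟨hj, hz⟩, rfl⟩⟩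
      rintro (rfl | ⟨i, hi, hij⟩)
      · exact (he ⟨j, hj, rfl⟩).elim
      · rw [← (h n n.lt_succ_self i hi.1 j hj).2 hij]
        exact hi.2

/-- Finitely many infinite sets have distinct representatives. -/
theorem exists_injOn_forall_mem {α β : Type*} [Nonempty β] {F : Set α} (hF : F.Finite)
    {C : α → Set β} (hC : ∀ x ∈ F, (C x).Infinite) :
    ∃ f : α → β, Set.InjOn f F ∧ ∀ x ∈ F, f x ∈ C x := by
  classical
  induction F, hF using Set.Finite.induction_on with
  | empty => exact ⟨fun _ => Classical.arbitrary β, by simp, by simp⟩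
  | @insert a F ha hF ih =>
    obtain ⟨f, hf, hfC⟩ := ih fun x hx => hC x (Set.mem_insert_of_mem _ hx)
    obtain ⟨b, hb, hbF⟩ := ((hC a (Set.mem_insert _ _)).sdiff (hF.image f)).nonempty
    have hne : ∀ x ∈ F, Function.update f a b x = f x := fun x hx =>
      by
      refine Function.update_of_ne ?_ _ _
      rintro rfl
      exact ha hx
    refine ⟨Function.update f a b, ?_, ?_⟩
    · rw [Set.injOn_insert ha]
      refine ⟨hf.congr fun x hx => (hne x hx).symm, ?_⟩
      rintro ⟨x, hx, hxb⟩
      rw [hne x hx, Function.update_self] at hxb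
      exact hbF ⟨x, hx, hxb⟩
    · rintro x (rfl | hx)
      · rwa [Function.update_self]
      · rw [hne x hx]
        exact hfC x hx

theorem exists_injOn_pat_eq {M N : Model} (hM : IsTypeTheory M) {K s : ℕ}
    {v : ∀ n, ℕ → M.dom n} {w : ∀ n, ℕ → N.dom n} (h : ∀ n < s, EqSim K v w n) {F : Set (N.dom s)}
    (hF : F.Finite) :
    ∃ f : N.dom s → M.dom s, Set.InjOn f F ∧ ∀ x ∈ F, pat K v s (f x) = pat K w s x := by
  have := M.nonempty s
  exact exists_injOn_forall_mem hF fun x _ =>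
    infinite_setOf_pat_eq hM (fun n hn i hi j hj => (h n hn i hi j hj).symm) x

theorem exists_sim_succ {M N : Model} (hM : IsTypeTheory M) {K s : ℕ}
    {v : ∀ n, ℕ → M.dom n} {w : ∀ n, ℕ → N.dom n} (h : ∀ n < s, Sim K v w n) :
    ∃ v' : ∀ n, ℕ → M.dom n, (∀ n, n ≠ s → v' n = v n) ∧ ∀ n < s + 1, Sim K v' w n := by
  obtain ⟨f, hf, hfp⟩ := exists_injOn_pat_eq hM (fun n hn => (h n hn).1)
    ((Set.finite_Iio K).image (w s))
  have hne : ∀ n, n ≠ s → Function.update v s (fun i => f (w s i)) n = v n := fun n hn =>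
    Function.update_of_ne hn _ _
  refine ⟨Function.update v s fun i => f (w s i), hne, fun n hn => ?_⟩
  rcases Nat.lt_succ_iff_lt_or_eq.1 hn with hn | rfl
  · exact (h n hn).congr fun m hm => (hne m (by omega)).symm
  · refine ⟨fun i hi j hj => ?_, fun j hj => ?_⟩
    · rw [Function.update_self]
      exact hf.eq_iff ⟨i, hi, rfl⟩ ⟨j, hj, rfl⟩
    · rw [Function.update_self, pat_congr fun m hm => hne m hm.ne]
      exact hfp _ ⟨j, hj, rfl⟩

/-! ### The types around the existential quantifiers -/

/-- Every finite set of objects of type `s` of `M` is mapped back into `N` by an injection that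
sends `v` to `w` and respects membership with respect to the types below and above. -/
def Back {M N : Model} (K s : ℕ) (v : ∀ n, ℕ → M.dom n) (w : ∀ n, ℕ → N.dom n) : Prop :=
  ∀ Y : Set (M.dom s), Y.Finite → ∃ h : M.dom s → N.dom s, Set.InjOn h (Y ∪ v s '' Set.Iio K) ∧
    (∀ i < K, h (v s i) = w s i) ∧ (∀ z ∈ Y, pat K w s (h z) = pat K v s z) ∧
    ∀ z ∈ Y, ∀ j < K, N.mem (h z) (w (s + 1) j) ↔ M.mem z (v (s + 1) j)

/-- The indices `j < K` of those objects `w (s + 1) j` that the object `y` of type `s` is a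
member of. -/
def upperPat {N : Model} (K : ℕ) (w : ∀ n, ℕ → N.dom n) {s : ℕ} (y : N.dom s) : Set ℕ :=
  {j | j < K ∧ N.mem y (w (s + 1) j)}

/-- The objects of type `s` with the same members among the `w (s - 1) i` as `y`, and that belong
to the same `w (s + 1) j`. -/
def cell {N : Model} (K : ℕ) (w : ∀ n, ℕ → N.dom n) {s : ℕ} (y : N.dom s) : Set (N.dom s) :=
  {x | pat K w s x = pat K w s y ∧ upperPat K w x = upperPat K w y}

theorem finite_setOf_finite_cell {N : Model} (K : ℕ) (w : ∀ n, ℕ → N.dom n) (s : ℕ) :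
    {y : N.dom s | (cell K w y).Finite}.Finite := by
  let key : N.dom s → Set ℕ × Set ℕ := fun y => (pat K w s y, upperPat K w y)
  have hfin : (key '' {y | (cell K w y).Finite}).Finite := by
    refine (((Set.finite_Iio K).finite_subsets).prod ((Set.finite_Iio K).finite_subsets)).subset ?_
    rintro _ ⟨y, -, rfl⟩
    exact ⟨pat_subset w s y, fun j hj => hj.1⟩
  refine Set.Finite.of_finite_fibers key hfin ?_
  rintro _ ⟨y, hy, rfl⟩
  refine hy.subset fun x hx => ?_
  have : key x = key y := hx.2
  exact Prod.ext_iff.1 this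

/-- The copy of the parameters of types `s` and `s + 1`. The copied parameters of type `s + 1` agree
with `w` on the copies of a finite set `F` that contains all finite cells; every other element of
`M` belongs to the same of them as a fixed element of an infinite cell of `N`. -/
theorem exists_back {M N : Model} (hM : IsTypeTheory M) (hN : IsTypeTheory N) {K s : ℕ}
    {v : ∀ n, ℕ → M.dom n} {w : ∀ n, ℕ → N.dom n} (h : ∀ n < s, Sim K v w n) :
    ∃ v' : ∀ n, ℕ → M.dom n, (∀ n < s + 2, Sim K v' w n) ∧ Back K s v' w := by
  classical
  have hMs := M.nonempty s
  have hNs := N.nonempty s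
  -- In `N`, a finite set containing all finite cells, the given objects, and, for any two distinct
  -- given objects of type `s + 1`, an object that tells them apart.
  have hsep : ∀ j j', ∃ x : N.dom s, w (s + 1) j ≠ w (s + 1) j' →
      ¬ (N.mem x (w (s + 1) j) ↔ N.mem x (w (s + 1) j')) := fun j j' => by
    by_contra! hc
    obtain ⟨x⟩ := hNs
    exact (hc x).1 (hN.ext fun z => (hc z).2)
  choose d hd using hsep
  obtain ⟨F, hF, hcellF, hwF, hdF⟩ : ∃ F : Set (N.dom s), F.Finite ∧
      (∀ y ∉ F, (cell K w y).Infinite) ∧ (∀ i < K, w s i ∈ F) ∧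
      ∀ i < K, ∀ j < K, d i j ∈ F := by
    refine ⟨{y | (cell K w y).Finite} ∪ w s '' Set.Iio K ∪
      (fun p : ℕ × ℕ => d p.1 p.2) '' (Set.Iio K ×ˢ Set.Iio K),
      ((finite_setOf_finite_cell K w s).union ((Set.finite_Iio K).image _)).union
      (((Set.finite_Iio K).prod (Set.finite_Iio K)).image _), ?_, ?_, ?_⟩
    · exact fun y hy hfin => hy (Or.inl (Or.inl hfin))
    · exact fun i hi => Or.inl (Or.inr ⟨i, hi, rfl⟩)
    · exact fun i hi j hj => Or.inr ⟨(i, j), ⟨hi, hj⟩, rfl⟩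
  obtain ⟨f, hf, hfp⟩ := exists_injOn_pat_eq hM (fun n hn => (h n hn).1) hF
  -- For every pattern with respect to the type below, an object in an infinite cell.
  have hy : ∀ p : Set ℕ, ∃ y : N.dom s, (∃ z, pat K v s z = p) → y ∉ F ∧ pat K w s y = p := by
    intro p
    by_cases hp : ∃ z, pat K v s z = p
    · obtain ⟨z, rfl⟩ := hp
      obtain ⟨y, hy, hyF⟩ :=
        ((infinite_setOf_pat_eq hN (fun n hn => (h n hn).1) z).sdiff hF).nonempty
      exact ⟨y, fun _ => ⟨hyF, hy⟩⟩
    · obtain ⟨y⟩ := hNs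
      exact ⟨y, fun h => (hp h).elim⟩
  choose y hy using hy
  have hG : ∀ b : N.dom (s + 1), Internal M
      (f '' {x ∈ F | N.mem x b} ∪ ((f '' F)ᶜ ∩ {z | N.mem (y (pat K v s z)) b})) := fun b =>
    hM.union (hM.of_finite ((hF.subset fun x hx => hx.1).image f))
      (hM.inter (hM.compl (hM.of_finite (hF.image f)))
        (hM.internal_pat K v s fun p => N.mem (y p) b))
  choose G hG using hG
  have hGf : ∀ b, ∀ x ∈ F, (M.mem (f x) (G b) ↔ N.mem x b) := by
    intro b x hx
    rw [hG]
    constructor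
    · rintro (⟨x', ⟨hx', hb⟩, hxx⟩ | ⟨hn, -⟩)
      · rwa [← hf hx' hx hxx]
      · exact (hn ⟨x, hx, rfl⟩).elim
    · exact fun hb => Or.inl ⟨x, ⟨hx, hb⟩, rfl⟩
  have hGn : ∀ b, ∀ z ∉ f '' F, (M.mem z (G b) ↔ N.mem (y (pat K v s z)) b) := by
    intro b z hz
    rw [hG]
    constructor
    · rintro (⟨x, hx, rfl⟩ | hz')
      · exact (hz ⟨x, hx.1, rfl⟩).elim
      · exact hz'.2
    · exact fun hb => Or.inr ⟨hz, hb⟩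
  obtain ⟨v', hv', hv's, hv'G⟩ : ∃ v' : ∀ n, ℕ → M.dom n, (∀ n < s, v' n = v n) ∧
      (v' s = fun i => f (w s i)) ∧ v' (s + 1) = fun i => G (w (s + 1) i) := by
    refine ⟨Function.update (Function.update v s fun i => f (w s i)) (s + 1)
      fun i => G (w (s + 1) i), fun n hn => ?_, ?_, Function.update_self ..⟩
    · rw [Function.update_of_ne (by omega), Function.update_of_ne hn.ne]
    · rw [Function.update_of_ne (by omega), Function.update_self]
  have hpat : ∀ z, pat K v' s z = pat K v s z := pat_congr hv'
  refine ⟨v', fun n hn => ?_, fun Y hY => ?_⟩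
  · obtain hn | rfl | rfl : n < s ∨ n = s ∨ n = s + 1 := by omega
    · exact (h n hn).congr fun m hm => (hv' m (by omega)).symm
    · refine ⟨fun i hi j hj => ?_, fun j hj => ?_⟩
      · rw [hv's]
        exact hf.eq_iff (hwF i hi) (hwF j hj)
      · rw [hpat, hv's]
        exact hfp _ (hwF j hj)
    · refine ⟨fun i hi j hj => ?_, fun j hj => ?_⟩
      · rw [hv'G]
        refine ⟨fun hij => by_contra fun hne => hd i j hne ?_, fun hij => by simp only [hij]⟩
        rw [← hGf _ _ (hdF i hi j hj), ← hGf _ _ (hdF i hi j hj)]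
        exact iff_of_eq (congrArg _ hij)
      · ext i
        simp only [pat, Set.mem_ofPred_eq, hv's, hv'G]
        exact and_congr_right fun hi => hGf _ _ (hwF i hi)
  · -- Objects outside of `f '' F` are sent into the infinite cell chosen for their pattern.
    have hinf : ∀ z ∈ Y, (cell K w (y (pat K v s z)) \ F).Infinite := fun z _ =>
      (hcellF _ (hy _ ⟨z, rfl⟩).1).sdiff hF
    obtain ⟨g, hg, hgC⟩ := exists_injOn_forall_mem hY hinf
    let k : M.dom s → N.dom s := fun z => if z ∈ f '' F then Function.invFunOn f F z else g z
    have hkf : ∀ x ∈ F, k (f x) = x := fun x hx => by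
      have hx' : f x ∈ f '' F := ⟨x, hx, rfl⟩
      simp only [k, if_pos hx']
      exact hf (Function.invFunOn_mem hx') hx (Function.invFunOn_eq hx')
    have hkg : ∀ z ∉ f '' F, k z = g z := fun z hz => if_neg hz
    refine ⟨k, ?_, fun i hi => by rw [hv's]; exact hkf _ (hwF i hi), fun z hz => ?_,
      fun z hz j hj => ?_⟩
    · have hsub : ∀ z ∈ Y ∪ v' s '' Set.Iio K, z ∈ f '' F ∨ z ∉ f '' F ∧ z ∈ Y := by
        rintro z (hz | ⟨i, hi, rfl⟩)
        · by_cases hzF : z ∈ f '' F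
          · exact Or.inl hzF
          · exact Or.inr ⟨hzF, hz⟩
        · rw [hv's]
          exact Or.inl ⟨_, hwF i hi, rfl⟩
      intro z hz z' hz' hzz
      rcases hsub z hz with ⟨x, hx, rfl⟩ | ⟨hzF, hzY⟩ <;>
        rcases hsub z' hz' with ⟨x', hx', rfl⟩ | ⟨hzF', hzY'⟩
      · rw [hkf x hx, hkf x' hx'] at hzz
        rw [hzz]
      · rw [hkf x hx, hkg z' hzF'] at hzz
        exact ((hgC z' hzY').2 (hzz ▸ hx)).elim
      · rw [hkf x' hx', hkg z hzF] at hzz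
        exact ((hgC z hzY).2 (hzz ▸ hx')).elim
      · rw [hkg z hzF, hkg z' hzF'] at hzz
        exact hg hzY hzY' hzz
    · rw [hpat]
      by_cases hzF : z ∈ f '' F
      · obtain ⟨x, hx, rfl⟩ := hzF
        rw [hkf x hx, hfp x hx]
      · rw [hkg z hzF, (hgC z hz).1.1]
        exact (hy _ ⟨z, rfl⟩).2
    · rw [hv'G]
      by_cases hzF : z ∈ f '' F
      · obtain ⟨x, hx, rfl⟩ := hzF
        rw [hkf x hx]
        exact (hGf _ x hx).symm
      · rw [hkg z hzF, hGn _ z hzF]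
        have := Set.ext_iff.1 (hgC z hz).1.2 j
        simpa [upperPat, hj] using this

/-- Arbitrary parameters in `N` can be copied to `M`, type by type. -/
theorem exists_sim {M N : Model} (hM : IsTypeTheory M) (K n : ℕ) (w : ∀ n, ℕ → N.dom n) :
    ∃ v : ∀ n, ℕ → M.dom n, ∀ m < n, Sim K v w m := by
  induction n with
  | zero =>
    have := M.nonempty
    exact ⟨fun n _ => Classical.arbitrary _, fun m hm => (Nat.not_lt_zero m hm).elim⟩
  | succ n ih =>
    obtain ⟨v, hv⟩ := ih
    obtain ⟨v', -, hv'⟩ := exists_sim_succ hM hv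
    exact ⟨v', hv'⟩

/-- Once the types up to `s + 1` are copied by `exists_back`, the higher types are copied without
affecting `Back`. -/
theorem exists_sim_back {M N : Model} (hM : IsTypeTheory M) (hN : IsTypeTheory N) (K s n : ℕ)
    (w : ∀ n, ℕ → N.dom n) :
    ∃ v : ∀ n, ℕ → M.dom n, (∀ m < n + (s + 2), Sim K v w m) ∧ Back K s v w := by
  induction n with
  | zero =>
    obtain ⟨v, hv⟩ := exists_sim hM K s w
    simpa using exists_back hM hN hv
  | succ n ih =>
    obtain ⟨v, hv, hb⟩ := ih
    obtain ⟨v', hne, hv'⟩ := exists_sim_succ hM hv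
    refine ⟨v', fun m hm => hv' m (by omega), ?_⟩
    have hpat : ∀ z, pat K v' s z = pat K v s z :=
      pat_congr fun m hm => hne m (by omega)
    simpa only [Back, hpat, hne s (by omega), hne (s + 1) (by omega)] using hb

/-! ### Transfer -/

/-- The truth of a quantifier-free formula depends only on finitely many equations and
memberships. -/
theorem exists_sat_iff_of_quantifierFree {θ : Formula} (hθ : θ.QuantifierFree) :
    ∃ K, ∀ (M N : Model) (v : ∀ n, ℕ → M.dom n) (w : ∀ n, ℕ → N.dom n),
      (∀ n < K, EqSim K v w n) →
      (∀ n < K, ∀ i < K, ∀ j < K, M.mem (v n i) (v (n + 1) j) ↔ N.mem (w n i) (w (n + 1) j)) →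
      (Sat M θ v ↔ Sat N θ w) := by
  induction θ with
  | eq n i j =>
    exact ⟨n + i + j + 1, fun M N v w h _ => h n (by omega) i (by omega) j (by omega)⟩
  | mem n i j =>
    exact ⟨n + i + j + 1, fun M N v w _ h => h n (by omega) i (by omega) j (by omega)⟩
  | falsum => exact ⟨0, fun _ _ _ _ _ _ => Iff.rfl⟩
  | imp φ ψ ih₁ ih₂ =>
    obtain ⟨K₁, h₁⟩ := ih₁ hθ.1
    obtain ⟨K₂, h₂⟩ := ih₂ hθ.2
    refine ⟨K₁ + K₂, fun M N v w he hm => imp_congr (h₁ M N v w ?_ ?_) (h₂ M N v w ?_ ?_)⟩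
    · exact fun n hn i hi j hj => he n (by omega) i (by omega) j (by omega)
    · exact fun n hn i hi j hj => hm n (by omega) i (by omega) j (by omega)
    · exact fun n hn i hi j hj => he n (by omega) i (by omega) j (by omega)
    · exact fun n hn i hi j hj => hm n (by omega) i (by omega) j (by omega)
  | all n φ => exact hθ.elim

theorem mem_iff_of_pat_eq {M N : Model} {K : ℕ} {v : ∀ n, ℕ → M.dom n} {w : ∀ n, ℕ → N.dom n}
    {n : ℕ} {z : M.dom (n + 1)} {y : N.dom (n + 1)} (h : pat K v (n + 1) z = pat K w (n + 1) y)
    {i : ℕ} (hi : i < K) : M.mem (v n i) z ↔ N.mem (w n i) y := by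
  have := Set.ext_iff.1 h i
  simpa [pat, hi] using this

/-- Truth of `∀x⃗∃y⃗θ` transfers from `M` to `N`: the parameters `w` in `N` are copied to parameters
in `M`, and the solution found there is brought back. -/
theorem forall_sat_exBlock_transfer {M N : Model} (hM : IsTypeTheory M) (hN : IsTypeTheory N)
    {θ : Formula} (hθ : θ.QuantifierFree) (l s : ℕ)
    (h : ∀ v, Sat M (exBlock (List.replicate l s) θ) v) (w : ∀ n, ℕ → N.dom n) :
    Sat N (exBlock (List.replicate l s) θ) w := by
  obtain ⟨K, hK⟩ := exists_sat_iff_of_quantifierFree hθ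
  obtain ⟨v, hsim, hback⟩ := exists_sim_back hM hN K s K w
  obtain ⟨v', hne, hshift, hsat⟩ := (sat_exBlock_replicate l s θ v).1 (h v)
  obtain ⟨k, hkinj, hkv, hkpat, hkmem⟩ :=
    hback (v' s '' Set.Iio l) ((Set.finite_Iio l).image _)
  rw [sat_exBlock_replicate]
  let w' : ∀ n, ℕ → N.dom n :=
    Function.update w s fun i => if i < l then k (v' s i) else w s (i - l)
  have hw' : ∀ n, n ≠ s → w' n = w n := fun n hn => Function.update_of_ne hn _ _
  have hw's : ∀ i, w' s i = if i < l then k (v' s i) else w s (i - l) := fun i => by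
    simp [w']
  refine ⟨w', hw', fun i => by simp [hw's], ?_⟩
  have hv's : ∀ i, ¬ i < l → v' s i = v s (i - l) := fun i hi => by
    rw [← hshift, Nat.sub_add_cancel (not_lt.1 hi)]
  have hw'k : ∀ i < K, w' s i = k (v' s i) := fun i hi => by
    rw [hw's]
    split_ifs with hil
    · rfl
    · rw [hv's i hil, hkv _ (by omega)]
  have hmemdom : ∀ i < K, v' s i ∈ v' s '' Set.Iio l ∪ v s '' Set.Iio K := fun i hi => by
    by_cases hil : i < l
    · exact Or.inl ⟨i, hil, rfl⟩
    · exact Or.inr ⟨i - l, by simp only [Set.mem_Iio]; omega, (hv's i hil).symm⟩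
  -- On all values of the variables of sort `s`, old and new, `k` respects the neighbouring types.
  have hpat : ∀ i < K, pat K v s (v' s i) = pat K w s (w' s i) := fun i hi => by
    rw [hw's]
    split_ifs with hil
    · exact (hkpat _ ⟨i, hil, rfl⟩).symm
    · rw [hv's i hil]
      exact (hsim s (by omega)).2 _ (by omega)
  have hup : ∀ i < K, ∀ j < K, M.mem (v' s i) (v (s + 1) j) ↔ N.mem (w' s i) (w (s + 1) j) :=
    fun i hi j hj => by
      rw [hw's]
      split_ifs with hil
      · exact (hkmem _ ⟨i, hil, rfl⟩ j hj).symm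
      · rw [hv's i hil]
        exact mem_iff_of_pat_eq ((hsim (s + 1) (by omega)).2 j hj) (by omega)
  refine (hK M N v' w' (fun n hn i hi j hj => ?_) fun n hn i hi j hj => ?_).1 hsat
  · by_cases hns : n = s
    · subst hns
      rw [hw'k i hi, hw'k j hj]
      exact (hkinj.eq_iff (hmemdom i hi) (hmemdom j hj)).symm
    · rw [hne n hns, hw' n hns]
      exact (hsim n (by omega)).1 i hi j hj
  · by_cases hns : n = s
    · subst hns
      rw [hne (n + 1) (by omega), hw' (n + 1) (by omega)]
      exact hup i hi j hj
    · rw [hne n hns, hw' n hns]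
      by_cases hns' : n + 1 = s
      · subst hns'
        exact mem_iff_of_pat_eq (hpat j hj) hi
      · rw [hne (n + 1) hns', hw' (n + 1) hns']
        exact mem_iff_of_pat_eq ((hsim (n + 1) (by omega)).2 j hj) hi

end TST

theorem mainTheorem2 (r : List ℕ) (s l : ℕ) (θ : TST.Formula) (hθ : θ.QuantifierFree)
    (hφ : (TST.Formula.allBlock r
      (TST.Formula.exBlock (List.replicate l s) θ)).IsSentence) :
    TST.Decides TST.tsti
      (TST.Formula.allBlock r (TST.Formula.exBlock (List.replicate l s) θ)) := by
  open TST in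
  have model : ∀ ψ : Formula, ψ.IsSentence → ¬ Proves (insert ψ tsti) Formula.falsum →
      ∃ M : Model, IsTypeTheory M ∧ ∃ v, Sat M ψ v := by
    intro ψ hψ hc
    obtain ⟨M, v, hv⟩ := exists_model_of_not_proves (fun χ hχ => by
      rcases hχ with rfl | hχ
      · exact hψ
      · exact isSentence_of_mem_tsti hχ) hc
    exact ⟨M, isTypeTheory_of_sat fun χ hχ => hv χ (Or.inr hχ), v, hv ψ (Or.inl rfl)⟩
  by_contra hdec
  obtain ⟨hpos, hneg⟩ := not_or.1 hdec
  obtain ⟨N, hN, w, hw⟩ := model (TST.Formula.neg _)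
    (fun m k hmk => hmk.elim (hφ m k) id) fun h => hpos (.raa h)
  obtain ⟨M, hM, v, hv⟩ := model _ hφ fun h => hneg (.impI h)
  refine hw ((TST.forall_sat_allBlock r _).2 (fun w' => ?_) w)
  exact TST.forall_sat_exBlock_transfer hM hN hθ l s
    ((TST.forall_sat_allBlock r _).1 fun v' => (hφ.sat_congr v v').1 hv) w'
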